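/- Let $\mathbb{L} = \mathbb{R}((x))$ be the field of formal Laurent series in one variable over $\mathbb{R}$, linearly ordered by declaring a nonzero series $\sum_{i \ge n} a_i x^i$ with $a_n \neq 0$ to be positive if and only if $a_n > 0$, and equipped with the field-metric $d : \mathbb{L} \times \mathbb{L} \to \mathbb{L}$, $d(y,z) = |y - z|$ (where $|w| = \max(w,-w)$). Call $r, s \in \mathbb{L}$ infinitesimally close if $|r - s| < 1/n$ for every positive integer $n$, and regard $\mathbb{R} \subseteq \mathbb{L}$ as the constant series. Let $f : \mathbb{L} \to \mathbb{L}$ be a function for which there exist a real number $a \in [0,1)$ and an element $r \in \mathbb{L}$ infinitesimally close to $a$ such that \[ d(f(y), f(z)) \le r \cdot d(y,z) \quad \text{for all } y, z \in \mathbb{L}. \] Then $f$ has a unique fixed point, i.e. there is exactly one $y \in \mathbb{L}$ with $f(y) = y$. -/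

import Mathlib

/-- A field-metric on `X` with values in the linearly ordered field `F`. -/
structure FieldMetric (X F : Type*) [Field F] [LinearOrder F] [IsStrictOrderedRing F] where
  d : X → X → F
  symm : ∀ x y, d x y = d y x
  triangle : ∀ x y z, d x z ≤ d x y + d y z
  eq_zero_iff : ∀ x y, d x y = 0 ↔ x = y

/-- The field-metric `d(x, y) = |x - y|` of a linearly ordered field on itself. -/
def FieldMetric.self (F : Type*) [Field F] [LinearOrder F] [IsStrictOrderedRing F] :
    FieldMetric F F where
  d x y := |x - y|
  symm := abs_sub_comm
  triangle := abs_sub_le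
  eq_zero_iff x y := by rw [abs_eq_zero, sub_eq_zero]

/-- Two elements of a linearly ordered field are infinitesimally close if `|x - y| < 1 / n`
for every positive integer `n`. -/
def InfinitesimallyClose {F : Type*} [Field F] [LinearOrder F] [IsStrictOrderedRing F]
    (x y : F) : Prop :=
  ∀ n : ℕ, 0 < n → |x - y| < 1 / (n : F)

/-- The formal Laurent series over `ℝ`. The synonym `Lex` provides the linear order in which a
nonzero series is positive iff its coefficient of lowest degree is positive
(`HahnSeries.leadingCoeff_pos_iff`). -/
abbrev OrderedLaurent : Type := Lex (LaurentSeries ℝ)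

/-- The inclusion of `ℝ` into the Laurent series as the constant series. -/
noncomputable def OrderedLaurent.const (a : ℝ) : OrderedLaurent :=
  toLex (HahnSeries.C a : LaurentSeries ℝ)

/-- The field-metric `d(y, z) = |y - z|` on the field of formal Laurent series over `ℝ`. -/
noncomputable def OrderedLaurent.fieldMetric : FieldMetric OrderedLaurent OrderedLaurent :=
  FieldMetric.self OrderedLaurent

/-!
Strict contraction by a standard factor `b < 1` passes to coefficients: if `y` and `z` agree in all
degrees below `m`, then so do `f y` and `f z`, and the distance of their coefficients in degree `m`
shrinks by the factor `b`. Hence two series that `f` fixes in all degrees of an initial segment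
agree there. All such partial solutions therefore glue to a largest one. If it were not fixed by
`f`, then, at the first degree `m` where it fails, the Banach fixed point theorem for the
coefficient in degree `m` would extend it.
-/

theorem isWF_of_forall_isWF_inter_Iic {α : Type*} [Preorder α] {s : Set α}
    (h : ∀ i ∈ s, (s ∩ Set.Iic i).IsWF) : s.IsWF := by
  rw [Set.isWF_iff_no_descending_seq]
  intro u hu hus
  exact Set.isWF_iff_no_descending_seq.mp (h (u 0) (hus 0)) u hu
    fun n => ⟨hus n, hu.antitone n.zero_le⟩

section HahnSeries

variable {Γ E : Type*} [LinearOrder Γ] [Zero E]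

theorem exists_eqOn_Iio_coeff_ne {y z : HahnSeries Γ E} (h : y ≠ z) :
    ∃ m, Set.EqOn y.coeff z.coeff (Set.Iio m) ∧ y.coeff m ≠ z.coeff m := by
  let s : Set Γ := {i | y.coeff i ≠ z.coeff i}
  have hs : s.IsWF := (y.isWF_support.union z.isWF_support).mono fun i hi => by
    by_contra! hi'
    simp_all [s]
  have hne : s.Nonempty := Function.ne_iff.mp (HahnSeries.coeff_injective.ne h)
  exact ⟨hs.min hne, fun i hi => not_not.mp fun hi' => hs.not_lt_min hne hi' hi, hs.min_mem hne⟩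

theorem exists_eqOn_Iic_of_compatible {s : Set Γ} {z : Γ → HahnSeries Γ E}
    (hz : ∀ i ∈ s, ∀ j ∈ s, j ≤ i → Set.EqOn (z j).coeff (z i).coeff (Set.Iic j))
    (hs : IsLowerSet s) :
    ∃ x : HahnSeries Γ E, ∀ i ∈ s, Set.EqOn x.coeff (z i).coeff (Set.Iic i) := by
  classical
  let c : Γ → E := fun i => if i ∈ s then (z i).coeff i else 0
  have hc : ∀ i ∈ s, Set.EqOn c (z i).coeff (Set.Iic i) := fun i hi j hji => by
    simpa only [c, if_pos (hs hji hi)] using hz i hi j (hs hji hi) hji Set.self_mem_Iic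
  have hwf : (Function.support c).IsWF := isWF_of_forall_isWF_inter_Iic fun i hi => by
    have his : i ∈ s := not_not.mp fun his => hi (if_neg his)
    refine (z i).isWF_support.mono fun j hj => ?_
    rw [HahnSeries.mem_support, ← hc i his hj.2]
    exact hj.1
  exact ⟨⟨c, hwf.isPWO⟩, hc⟩

end HahnSeries

/-- The Hahn series obtained from `z` by replacing its coefficient in degree `m` with `c`. -/
def updateCoeff {Γ E : Type*} [PartialOrder Γ] [DecidableEq Γ] [Zero E] (z : HahnSeries Γ E) (m : Γ)
    (c : E) : HahnSeries Γ E where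
  coeff := Function.update z.coeff m c
  isPWO_support' := (z.isPWO_support.insert m).mono fun i hi => by
    by_contra! hi'
    simp_all [Function.update_apply]

/-- A self-map `f` of the Hahn series with coefficients in a metric space is a leading contraction
with constant `K < 1` if it shrinks by the factor `K` the distance of the coefficients in degree `m`
of any two series that agree in all degrees below `m`. The degree `m` need not be the first one
where the two series differ; if they agree in degree `m` as well, then so do their images. -/
def LeadingContractingWith {Γ E : Type*} [PartialOrder Γ] [Zero E] [MetricSpace E] (K : NNReal)
    (f : HahnSeries Γ E → HahnSeries Γ E) : Prop :=
  K < 1 ∧ ∀ ⦃y z : HahnSeries Γ E⦄ ⦃m : Γ⦄, Set.EqOn y.coeff z.coeff (Set.Iio m) →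
    dist ((f y).coeff m) ((f z).coeff m) ≤ K * dist (y.coeff m) (z.coeff m)

namespace LeadingContractingWith

section PartialOrder

variable {Γ E : Type*} [PartialOrder Γ] [Zero E] [MetricSpace E] {K : NNReal}
  {f : HahnSeries Γ E → HahnSeries Γ E}

theorem eqOn_map (hf : LeadingContractingWith K f) {s : Set Γ} (hs : IsLowerSet s)
    {y z : HahnSeries Γ E} (h : Set.EqOn y.coeff z.coeff s) :
    Set.EqOn (f y).coeff (f z).coeff s := fun i hi => by
  have hdist := hf.2 (h.mono fun j (hj : j < i) => hs hj.le hi)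
  rw [h hi, dist_self, mul_zero] at hdist
  exact dist_le_zero.mp hdist

theorem exists_eqOn_map_self_Iic [CompleteSpace E] (hf : LeadingContractingWith K f)
    {z : HahnSeries Γ E} {m : Γ} (hz : Set.EqOn (f z).coeff z.coeff (Set.Iio m)) :
    ∃ x : HahnSeries Γ E, Set.EqOn (f x).coeff x.coeff (Set.Iic m) := by
  classical
  have hupd (c : E) : Set.EqOn (updateCoeff z m c).coeff z.coeff (Set.Iio m) :=
    fun i hi => Function.update_of_ne hi.ne _ _
  have hupd_self (c : E) : (updateCoeff z m c).coeff m = c := by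
    simp only [updateCoeff, Function.update_self]
  have hcontr : ContractingWith K fun c => (f (updateCoeff z m c)).coeff m :=
    ⟨hf.1, LipschitzWith.of_dist_le_mul fun c d => by
      simpa only [hupd_self] using hf.2 ((hupd c).trans (hupd d).symm)⟩
  have : Nonempty E := ⟨0⟩
  let c := hcontr.fixedPoint
  refine ⟨updateCoeff z m c, fun i hi => ?_⟩
  rcases (Set.mem_Iic.mp hi).lt_or_eq with him | rfl
  · exact ((hf.eqOn_map (isLowerSet_Iio m) (hupd c)).trans (hz.trans (hupd c).symm)) him
  · exact hcontr.fixedPoint_isFixedPt.eq.trans (hupd_self c).symm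

end PartialOrder

section LinearOrder

variable {Γ E : Type*} [LinearOrder Γ] [Zero E] [MetricSpace E] {K : NNReal}
  {f : HahnSeries Γ E → HahnSeries Γ E}

theorem eqOn_of_eqOn_map_self (hf : LeadingContractingWith K f) {s : Set Γ} (hs : IsLowerSet s)
    {y z : HahnSeries Γ E} (hy : Set.EqOn (f y).coeff y.coeff s)
    (hz : Set.EqOn (f z).coeff z.coeff s) : Set.EqOn y.coeff z.coeff s := fun i hi => by
  by_contra hne
  obtain ⟨m, hlt, hm⟩ := exists_eqOn_Iio_coeff_ne (y := y) (z := z) fun h => hne (h ▸ rfl)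
  have hms : m ∈ s := hs (not_lt.mp fun him => hne (hlt him)) hi
  have hdist := hf.2 hlt
  rw [hy hms, hz hms] at hdist
  exact (mul_lt_of_lt_one_left (dist_pos.mpr hm) hf.1).not_ge hdist

variable [CompleteSpace E]

theorem exists_fixedPoint (hf : LeadingContractingWith K f) : ∃ x, f x = x := by
  let s : Set Γ := {i | ∃ z : HahnSeries Γ E, Set.EqOn (f z).coeff z.coeff (Set.Iic i)}
  have hs : IsLowerSet s := fun i j hji ⟨z, hz⟩ => ⟨z, hz.mono (Set.Iic_subset_Iic.mpr hji)⟩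
  choose! z hz using fun i (hi : i ∈ s) => hi
  obtain ⟨x, hx⟩ := exists_eqOn_Iic_of_compatible (z := z) (fun i hi j hj hji =>
    hf.eqOn_of_eqOn_map_self (isLowerSet_Iic j) (hz j hj)
      ((hz i hi).mono (Set.Iic_subset_Iic.mpr hji))) hs
  have hxs : Set.EqOn (f x).coeff x.coeff s := fun i hi =>
    ((hf.eqOn_map (isLowerSet_Iic i) (hx i hi)).trans ((hz i hi).trans (hx i hi).symm))
      Set.self_mem_Iic
  refine ⟨x, by_contra fun hne => ?_⟩
  obtain ⟨m, hlt, hm⟩ := exists_eqOn_Iio_coeff_ne hne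
  exact hm (hxs (hf.exists_eqOn_map_self_Iic hlt))

theorem existsUnique_fixedPoint (hf : LeadingContractingWith K f) : ∃! x, f x = x := by
  obtain ⟨x, hx⟩ := hf.exists_fixedPoint
  refine ⟨x, hx, fun y hy => HahnSeries.coeff_injective ((Set.eqOn_univ ..).mp ?_)⟩
  exact hf.eqOn_of_eqOn_map_self isLowerSet_univ (fun _ _ => by rw [hy]) (fun _ _ => by rw [hx])

end LinearOrder

end LeadingContractingWith

section Lex

variable {Γ R : Type*} [LinearOrder Γ]

theorem coeff_le_coeff_of_eqOn_Iio [Zero R] [PartialOrder R] {u v : Lex (HahnSeries Γ R)} {m : Γ}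
    (huv : u ≤ v) (h : Set.EqOn (ofLex u).coeff (ofLex v).coeff (Set.Iio m)) :
    (ofLex u).coeff m ≤ (ofLex v).coeff m := by
  rcases huv.eq_or_lt with rfl | hlt
  · exact le_rfl
  obtain ⟨i, hagree, hi⟩ := (HahnSeries.lt_iff _ _).mp hlt
  rcases lt_trichotomy i m with him | rfl | hmi
  · exact absurd (h him) hi.ne
  · exact hi.le
  · exact (hagree m hmi).le

section OrderedGroup

variable [AddCommGroup R] [LinearOrder R] [IsOrderedAddMonoid R]

theorem orderTop_le_orderTop_of_abs_le_abs {u v : Lex (HahnSeries Γ R)} (h : |u| ≤ |v|) :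
    (ofLex v).orderTop ≤ (ofLex u).orderTop :=
  not_lt.mp fun hlt => (HahnSeries.abs_lt_abs_of_orderTop_ofLex hlt).not_ge h

theorem coeff_abs_of_le_orderTop {w : Lex (HahnSeries Γ R)} {m : Γ}
    (hm : m ≤ (ofLex w).orderTop) : (ofLex |w|).coeff m = |(ofLex w).coeff m| := by
  have hnonneg : 0 ≤ (ofLex |w|).coeff m :=
    coeff_le_coeff_of_eqOn_Iio (abs_nonneg w) fun i hi =>
      (HahnSeries.le_orderTop_iff_forall.mp ((HahnSeries.orderTop_abs w).symm ▸ hm) i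
        (WithTop.coe_lt_coe.mpr hi)).symm
  rcases abs_choice w with h | h <;> rw [h] at hnonneg ⊢
  · exact (abs_of_nonneg hnonneg).symm
  · exact (abs_of_nonpos (neg_nonneg.mp hnonneg)).symm

theorem abs_coeff_le_smul_abs_coeff {S : Type*} [SMulZeroClass S R] {b : S}
    {u w : Lex (HahnSeries Γ R)} (h : |u| ≤ b • |w|) {m : Γ} (hm : m ≤ (ofLex w).orderTop) :
    |(ofLex u).coeff m| ≤ b • |(ofLex w).coeff m| := by
  have hsmul : m ≤ (ofLex (b • |w|)).orderTop :=
    (hm.trans_eq (HahnSeries.orderTop_abs w).symm).trans (HahnSeries.orderTop_le_orderTop_smul ..)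
  have hu : m ≤ (ofLex u).orderTop :=
    hsmul.trans (orderTop_le_orderTop_of_abs_le_abs (h.trans (le_abs_self _)))
  rw [← coeff_abs_of_le_orderTop hu, ← coeff_abs_of_le_orderTop hm]
  refine coeff_le_coeff_of_eqOn_Iio h fun i hi => ?_
  have hi' : (i : WithTop Γ) < m := WithTop.coe_lt_coe.mpr hi
  rw [HahnSeries.coeff_eq_zero_of_lt_orderTop (hi'.trans_le hsmul),
    HahnSeries.coeff_eq_zero_of_lt_orderTop
      (hi'.trans_le (hu.trans_eq (HahnSeries.orderTop_abs u).symm))]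

end OrderedGroup

theorem leadingContractingWith_of_abs_sub_le {f : Lex (HahnSeries Γ ℝ) → Lex (HahnSeries Γ ℝ)}
    {b : NNReal} (hb : b < 1) (hf : ∀ y z, |f y - f z| ≤ (b : ℝ) • |y - z|) :
    LeadingContractingWith b fun y => ofLex (f (toLex y)) := by
  refine ⟨hb, fun y z m h => ?_⟩
  have hm : m ≤ (y - z).orderTop := HahnSeries.le_orderTop_iff_forall.mpr fun i hi => by
    rw [HahnSeries.coeff_sub, h (WithTop.coe_lt_coe.mp hi), sub_self]
  exact abs_coeff_le_smul_abs_coeff (hf (toLex y) (toLex z)) hm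

end Lex

theorem InfinitesimallyClose.lt_map_of_lt {K F : Type*} [Field K] [LinearOrder K]
    [IsStrictOrderedRing K] [Archimedean K] [Field F] [LinearOrder F] [IsStrictOrderedRing F]
    {φ : K →+* F} (hφ : Monotone φ) {r : F} {a b : K} (hr : InfinitesimallyClose r (φ a))
    (hab : a < b) : r < φ b := by
  obtain ⟨n, hn⟩ := exists_nat_one_div_lt (sub_pos.mpr hab)
  have hinv : φ (1 / ((n + 1 : ℕ) : K)) = 1 / ((n + 1 : ℕ) : F) := by
    rw [map_div₀, map_one, map_natCast]
  have hlt : r - φ a < φ (1 / ((n + 1 : ℕ) : K)) :=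
    (lt_of_abs_lt (hr (n + 1) n.succ_pos)).trans_eq hinv.symm
  calc
    r < φ (1 / ((n + 1 : ℕ) : K)) + φ a := sub_lt_iff_lt_add.mp hlt
    _ = φ (1 / ((n + 1 : ℕ) : K) + a) := (map_add ..).symm
    _ ≤ φ b := hφ (by push_cast; linarith)

/-- The embedding of the coefficients as the constants of the lexicographically ordered Hahn series,
that is, `HahnSeries.C` with values in the type synonym that carries the order. -/
noncomputable def lexC (Γ R : Type*) [AddCommMonoid Γ] [LinearOrder Γ] [IsOrderedCancelAddMonoid Γ]
    [NonAssocSemiring R] : R →+* Lex (HahnSeries Γ R) :=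
  (HahnSeries.C : R →+* HahnSeries Γ R)

theorem monotone_lexC {Γ R : Type*} [AddCommMonoid Γ] [LinearOrder Γ] [IsOrderedCancelAddMonoid Γ]
    [NonAssocSemiring R] [PartialOrder R] : Monotone (lexC Γ R) := fun a b hab => by
  rcases hab.eq_or_lt with rfl | hlt
  · exact le_rfl
  refine ((HahnSeries.lt_iff _ _).mpr ⟨0, fun i hi => ?_, ?_⟩).le
  · exact (HahnSeries.coeff_single_of_ne hi.ne).trans (HahnSeries.coeff_single_of_ne hi.ne).symm
  · exact (HahnSeries.coeff_single_same 0 a).trans_lt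
      (hlt.trans_eq (HahnSeries.coeff_single_same 0 b).symm)

theorem mainTheorem2_general {Γ : Type*} [AddCommGroup Γ] [LinearOrder Γ] [IsOrderedAddMonoid Γ]
    {f : Lex (HahnSeries Γ ℝ) → Lex (HahnSeries Γ ℝ)} {r : Lex (HahnSeries Γ ℝ)} {a : ℝ}
    (ha : a < 1) (hr : InfinitesimallyClose r (lexC Γ ℝ a))
    (hf : ∀ y z, |f y - f z| ≤ r * |y - z|) : ∃! x, f x = x := by
  obtain ⟨b, hab, hb⟩ := exists_between (max_lt ha one_pos)
  lift b to NNReal using ((le_max_right a 0).trans_lt hab).le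
  have hrb : r < lexC Γ ℝ b := hr.lt_map_of_lt monotone_lexC ((le_max_left a 0).trans_lt hab)
  have hfb (y z : Lex (HahnSeries Γ ℝ)) : |f y - f z| ≤ (b : ℝ) • |y - z| :=
    calc
      |f y - f z| ≤ r * |y - z| := hf y z
      _ ≤ lexC Γ ℝ b * |y - z| := mul_le_mul_of_nonneg_right hrb.le (abs_nonneg _)
      _ = (b : ℝ) • |y - z| := HahnSeries.C_mul_eq_smul
  exact (leadingContractingWith_of_abs_sub_le (mod_cast hb) hfb).existsUnique_fixedPoint

theorem mainTheorem2 (f : OrderedLaurent → OrderedLaurent)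
    (hf : ∃ r : OrderedLaurent,
      (∃ a : ℝ, a ∈ Set.Ico (0 : ℝ) 1 ∧ InfinitesimallyClose r (OrderedLaurent.const a)) ∧
      ∀ y z : OrderedLaurent,
        OrderedLaurent.fieldMetric.d (f y) (f z) ≤ r * OrderedLaurent.fieldMetric.d y z) :
    ∃! x : OrderedLaurent, f x = x := by
  obtain ⟨r, ⟨a, ha, hr⟩, hf⟩ := hf
  exact mainTheorem2_general ha.2 hr hf
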